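/- Let $\mathcal H$ be a separable complex Hilbert space, let $\Lambda$ be a finite or countably infinite set, and let $\mathcal K=\ell^2(\Lambda)$ with its canonical orthonormal basis $(|i\rangle)_{i\in\Lambda}$. An open quantum random walk (OQRW) is given by bounded operators $B^i_j$ on $\mathcal H$ ($i,j\in\Lambda$) with $\sum_i (B^i_j)^*B^i_j=I$ strongly for every $j$; put $M^i_j=B^i_j\otimes|i\rangle\langle j|$. Fix an initial state $\rho^{(0)}=\sum_i\rho^{(0)}_i\otimes|i\rangle\langle i|$ with $\rho^{(0)}_i\ge 0$ of trace class and $\sum_i\mathrm{Tr}(\rho^{(0)}_i)=1$, and let $\rho^{(n)}=\sum_i\rho^{(n)}_i\otimes|i\rangle\langle i|$ be the state at time $n$, where $\rho^{(n+1)}_i=\sum_j B^i_j\rho^{(n)}_j(B^i_j)^*$. Let $\mathcal B\subset\mathcal B(\mathcal H\otimes\mathcal K)$ be the von Neumann algebra of bounded block-diagonal operators $\sum_j x(j)\otimes|j\rangle\langle j|$ (the weak closure of those with $\sum_j\|x(j)\|<\infty$). The quantum Markov chain (QMC) associated with the OQRW is the pair $(\rho^{(0)},(\mathcal E^{(n)})_{n\ge0})$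 with the transition expectations, for $x,y\in\mathcal B$, $$\mathcal E^{(n)}(x\otimes y)=\sum_{j:\,\rho^{(n)}_j\ne0}\ \sum_i\frac{\mathrm{Tr}\big((\rho^{(n)}_j\otimes|j\rangle\langle j|)\,x\big)}{\mathrm{Tr}(\rho^{(n)}_j)}\,(M^i_j)^*\,y\,M^i_j .$$ Let $\overline b(n)=\lim_{k\to\infty}\mathcal E^{(n)}(I\otimes\mathcal E^{(n+1)}(I\otimes\cdots\otimes\mathcal E^{(n+k)}(I\otimes I)))$ (strong limit). On the infinite tensor product $\mathcal A=\bigotimes_{k\ge0}\mathcal B$, spanned by the elementary tensors $a_0\otimes a_1\otimes\cdots$ with $a_k\in\mathcal B$ and multiplied entrywise, the map $E_{0]}$ is the (partially defined) linear map determined by $$E_{0]}(a_0\otimes a_1\otimes\cdots)=\lim_{n\to\infty}\mathcal E^{(0)}\big(a_0\otimes\mathcal E^{(1)}(a_1\otimes\cdots\otimes\mathcal E^{(n)}(a_n\otimes\overline b(n+1)))\big)$$ whenever the limit exists strongly (for finite linear combinations of elementary tensors, the limit is taken of the corresponding linear combination of the expressions on the right). The QMC is called reducible if there are a projection $p\in\mathcal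 B$ with $p\ne0,I$ and an $n_0\ge0$ such that, with $p_{[n_0}=I\otimes\cdots\otimes I\otimes p\otimes p\otimes\cdots$ ($p$ in all places $k\ge n_0$), one has $E_{0]}(p_{[n_0}\,a\,p_{[n_0})=E_{0]}(a)$ for all $a\in\mathcal A$ for which $E_{0]}(a)$ is defined (the left side being then also defined). Otherwise it is called irreducible. **Theorem.** Suppose that for every $j\in\Lambda$ and every $n=0,1,2,\dots$ the operator $\rho^{(n)}_j/\mathrm{Tr}(\rho^{(n)}_j)$ is (the density operator of) a faithful state on $\mathcal B(\mathcal H)$; in particular $\mathrm{Tr}(\rho^{(n)}_j)\neq0$. Then the QMC associated with the OQRW is irreducible. -/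

import Mathlib

open Filter Topology
open scoped InnerProductSpace ENNReal TensorProduct

noncomputable section

set_option linter.unusedSectionVars false

/-! ### Traces and states on a Hilbert space -/

namespace HilbertTrace

variable {H : Type*} [NormedAddCommGroup H] [InnerProductSpace ℂ H] [CompleteSpace H]

variable (H) in
/-- The index set of a fixed orthonormal (Hilbert) basis of `H`. -/
def onbIndex : Set H := Classical.choose (exists_hilbertBasis ℂ H)

variable (H) in
/-- A fixed orthonormal (Hilbert) basis of `H`. -/
def onb : HilbertBasis (onbIndex H) ℂ H :=
  Classical.choose (Classical.choose_spec (exists_hilbertBasis ℂ H))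

/-- The trace `∑ₖ ⟨eₖ, T eₖ⟩`. For trace class `T` the series converges absolutely and does not
depend on the orthonormal basis. -/
def trace (T : H →L[ℂ] H) : ℂ := ∑' k, ⟪onb H k, T (onb H k)⟫_ℂ

/-- The `[0, ∞]`-valued trace of a positive operator. A positive operator is of trace class exactly
when this is finite. -/
def posTrace (T : H →L[ℂ] H) : ℝ≥0∞ := ∑' k, ENNReal.ofReal (⟪onb H k, T (onb H k)⟫_ℂ).re

/-- `σ` is the density operator of a faithful (normal) state `a ↦ Tr (σ a)` on `B(H)`: it is
positive, has trace one, and `Tr (σ a) = 0` forces `a = 0` for every positive `a`. -/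
structure IsFaithfulState (σ : H →L[ℂ] H) : Prop where
  isPositive : σ.IsPositive
  posTrace_eq_one : posTrace σ = 1
  faithful : ∀ a : H →L[ℂ] H, a.IsPositive → trace (σ * a) = 0 → a = 0

/-- The squared Hilbert-Schmidt norm. -/
def hs (A : H →L[ℂ] H) : ℝ≥0∞ := ∑' k, ‖A (onb H k)‖ₑ ^ 2

lemma enorm_sq_eq (x : H) : ‖x‖ₑ ^ 2 = ∑' k, ‖⟪onb H k, x⟫_ℂ‖ₑ ^ 2 := by
  have h := (onb H).hasSum_inner_mul_inner x x
  have h1 : ∀ k, ⟪x, onb H k⟫_ℂ * ⟪onb H k, x⟫_ℂ = ((‖⟪onb H k, x⟫_ℂ‖ ^ 2 : ℝ) : ℂ) := by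
    intro k
    rw [← inner_conj_symm x, ← Complex.normSq_eq_conj_mul_self, Complex.normSq_eq_norm_sq]
  have h2 : HasSum (fun k => ‖⟪onb H k, x⟫_ℂ‖ ^ 2) (‖x‖ ^ 2) := by
    simp only [h1] at h
    have h' := Complex.reCLM.hasSum h
    simp only [Complex.reCLM_apply, Complex.ofReal_re] at h'
    rwa [← RCLike.re_eq_complex_re, ← norm_sq_eq_re_inner] at h'
  have h3 := ENNReal.ofReal_tsum_of_nonneg (fun k => sq_nonneg (‖⟪onb H k, x⟫_ℂ‖)) h2.summable
  rw [h2.tsum_eq] at h3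
  simpa [ENNReal.ofReal_pow] using h3

lemma hs_adjoint (A : H →L[ℂ] H) : hs (star A) = hs A := by
  unfold hs
  simp only [enorm_sq_eq (A _), enorm_sq_eq (star A _)]
  rw [ENNReal.tsum_comm]
  refine tsum_congr fun k => tsum_congr fun l => ?_
  rw [ContinuousLinearMap.star_eq_adjoint, ContinuousLinearMap.adjoint_inner_right,
    ← inner_conj_symm, ← ofReal_norm, RCLike.norm_conj, ofReal_norm]

lemma posTrace_star_mul_self (A : H →L[ℂ] H) : posTrace (star A * A) = hs A := by
  unfold posTrace hs
  refine tsum_congr fun k => ?_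
  rw [mul_apply_eq_comp, ContinuousLinearMap.star_eq_adjoint,
    ContinuousLinearMap.adjoint_inner_right, ← RCLike.re_eq_complex_re, ← norm_sq_eq_re_inner,
    ENNReal.ofReal_pow (norm_nonneg _), ofReal_norm]

lemma hs_mul_le (A B : H →L[ℂ] H) : hs (A * B) ≤ ‖A‖ₑ ^ 2 * hs B := by
  unfold hs
  rw [← ENNReal.tsum_mul_left]
  refine ENNReal.tsum_le_tsum fun k => ?_
  rw [← mul_pow]
  gcongr
  exact A.le_opENorm _

lemma exists_factor {T : H →L[ℂ] H} (hT : T.IsPositive) : ∃ S : H →L[ℂ] H, T = star S * S :=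
  CStarAlgebra.nonneg_iff_eq_star_mul_self.1
    ((ContinuousLinearMap.nonneg_iff_isPositive T).2 hT)

lemma norm_sq_le_hs (A : H →L[ℂ] H) (v : H) : ‖A v‖ₑ ^ 2 ≤ hs A * ‖v‖ₑ ^ 2 := by
  rw [enorm_sq_eq (A v), ← hs_adjoint, hs, ← ENNReal.tsum_mul_right]
  refine ENNReal.tsum_le_tsum fun k => ?_
  rw [← mul_pow, ← ContinuousLinearMap.adjoint_inner_left,
    ContinuousLinearMap.star_eq_adjoint]
  gcongr
  rw [← ofReal_norm, ← ofReal_norm, ← ofReal_norm,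
    ← ENNReal.ofReal_mul (norm_nonneg _)]
  exact ENNReal.ofReal_le_ofReal (norm_inner_le_norm _ _)

lemma opNorm_le_posTrace {T : H →L[ℂ] H} (hT : T.IsPositive) : ‖T‖ₑ ≤ posTrace T := by
  obtain ⟨S, rfl⟩ := exists_factor hT
  rw [posTrace_star_mul_self]
  have h1 : ‖star S * S‖ₑ = ‖S‖ₑ ^ 2 := by
    rw [← ofReal_norm, CStarRing.norm_star_mul_self,
      ENNReal.ofReal_mul (norm_nonneg _), ofReal_norm, sq]
  rw [h1]
  by_cases h : hs S = ∞
  · simp [h]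
  have h2 : ‖S‖ ≤ √(hs S).toReal := by
    refine S.opNorm_le_bound (Real.sqrt_nonneg _) fun v => ?_
    have := ENNReal.toReal_mono (by finiteness) (norm_sq_le_hs S v)
    simp only [ENNReal.toReal_pow, ENNReal.toReal_mul, toReal_enorm] at this
    refine le_of_sq_le_sq ?_ (by positivity)
    rw [mul_pow, Real.sq_sqrt ENNReal.toReal_nonneg]
    exact this
  rw [← ofReal_norm, ← ENNReal.ofReal_pow (norm_nonneg _)]
  refine ENNReal.ofReal_le_of_le_toReal ?_
  calc ‖S‖ ^ 2 ≤ (√(hs S).toReal) ^ 2 := by gcongr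
    _ = _ := Real.sq_sqrt ENNReal.toReal_nonneg

lemma summable_hs {A : H →L[ℂ] H} (h : hs A ≠ ∞) :
    HasSum (fun k => ‖A (onb H k)‖ ^ 2) (hs A).toReal := by
  have := (ENNReal.summable_toReal h).hasSum
  rw [← ENNReal.tsum_toReal_eq fun k => ENNReal.ne_top_of_tsum_ne_top h k] at this
  simp only [ENNReal.toReal_pow, toReal_enorm] at this
  exact this

/-- For positive trace class `T` and bounded `x`, the series defining `Tr (T x)` converges
absolutely, and `Tr (T x)` is controlled by the trace of `T`. -/
lemma summable_trace {T : H →L[ℂ] H} (hT : T.IsPositive) (h : posTrace T ≠ ∞) (x : H →L[ℂ] H) :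
    Summable (fun k => ⟪onb H k, (T * x) (onb H k)⟫_ℂ) ∧
      ‖trace (T * x)‖ ≤ (‖x‖ + 1) * (posTrace T).toReal := by
  obtain ⟨S, rfl⟩ := exists_factor hT
  rw [posTrace_star_mul_self] at h ⊢
  have hc : 0 < ‖x‖ + 1 := by positivity
  have hSx : hs (S * x) ≤ ‖x‖ₑ ^ 2 * hs S := by
    rw [← hs_adjoint, star_mul, ← hs_adjoint S]
    refine (hs_mul_le _ _).trans ?_
    rw [← ofReal_norm, ← ofReal_norm, norm_star]
  have hSx' : hs (S * x) ≠ ∞ := ne_top_of_le_ne_top (by finiteness) hSx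
  have hSxr : (hs (S * x)).toReal ≤ ‖x‖ ^ 2 * (hs S).toReal := by
    have := ENNReal.toReal_mono (by finiteness) hSx
    simpa using this
  have H1 := (((summable_hs h).mul_left (‖x‖ + 1)).add
    ((summable_hs hSx').mul_left (‖x‖ + 1)⁻¹)).mul_left (1 / 2 : ℝ)
  have hb : ∀ k, ‖⟪onb H k, (star S * S * x) (onb H k)⟫_ℂ‖ ≤
      1 / 2 * ((‖x‖ + 1) * ‖S (onb H k)‖ ^ 2 + (‖x‖ + 1)⁻¹ * ‖(S * x) (onb H k)‖ ^ 2) := by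
    intro k
    have e : ⟪onb H k, (star S * S * x) (onb H k)⟫_ℂ = ⟪S (onb H k), (S * x) (onb H k)⟫_ℂ := by
      rw [mul_assoc, mul_apply_eq_comp (star S), ContinuousLinearMap.star_eq_adjoint,
        ContinuousLinearMap.adjoint_inner_right]
    rw [e]
    refine (norm_inner_le_norm _ _).trans ?_
    set a := ‖S (onb H k)‖
    set b := ‖(S * x) (onb H k)‖
    have : 0 ≤ (‖x‖ + 1)⁻¹ * ((‖x‖ + 1) * a - b) ^ 2 := by positivity
    have e2 : (‖x‖ + 1)⁻¹ * ((‖x‖ + 1) * a - b) ^ 2 =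
        (‖x‖ + 1) * a ^ 2 - 2 * (a * b) + (‖x‖ + 1)⁻¹ * b ^ 2 := by
      field_simp
      ring
    linarith
  refine ⟨Summable.of_norm_bounded H1.summable hb, ?_⟩
  refine (tsum_of_norm_bounded H1 hb).trans ?_
  have hS0 : 0 ≤ (hs S).toReal := ENNReal.toReal_nonneg
  have h3 : (‖x‖ + 1)⁻¹ * (hs (S * x)).toReal ≤ (‖x‖ + 1) * (hs S).toReal := by
    rw [inv_mul_le_iff₀ hc]
    have : ‖x‖ ^ 2 ≤ (‖x‖ + 1) * (‖x‖ + 1) := by nlinarith [norm_nonneg x]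
    nlinarith
  linarith

lemma posTrace_conj_eq {T : H →L[ℂ] H} (hT : T.IsPositive) :
    ∃ S : H →L[ℂ] H, posTrace T = hs (star S) ∧
      ∀ B : H →L[ℂ] H, posTrace (B * T * star B) = hs (B * star S) := by
  obtain ⟨S, rfl⟩ := exists_factor hT
  refine ⟨S, by rw [posTrace_star_mul_self, hs_adjoint], fun B => ?_⟩
  have : B * (star S * S) * star B = star (S * star B) * (S * star B) := by
    simp [mul_assoc]
  rw [this, posTrace_star_mul_self, ← hs_adjoint]
  simp

end HilbertTrace

/-! ### Open quantum random walks -/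

open HilbertTrace

/-- An open quantum random walk with vertex set `Λ` and local Hilbert space `H`: bounded operators
`B i j` (the effect of passing from `j` to `i`) with `∑ᵢ (B i j)⋆ (B i j) = I` strongly, for
each `j`. -/
structure OpenQRW (Λ H : Type*) [NormedAddCommGroup H] [InnerProductSpace ℂ H]
    [CompleteSpace H] where
  B : Λ → Λ → (H →L[ℂ] H)
  hasSum_star_mul_self : ∀ (j : Λ) (v : H), HasSum (fun i => (star (B i j) * B i j) v) v

/-- A block-diagonal density operator `∑ᵢ ρᵢ ⊗ |i⟩⟨i|`, given by its blocks: positive operators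
`ρᵢ` on `H` with `∑ᵢ Tr ρᵢ = 1` (so that each of them is of trace class). -/
structure BlockState (Λ H : Type*) [NormedAddCommGroup H] [InnerProductSpace ℂ H]
    [CompleteSpace H] where
  block : Λ → (H →L[ℂ] H)
  isPositive : ∀ i, (block i).IsPositive
  tsum_posTrace : ∑' i, posTrace (block i) = 1

namespace OpenQRW

variable {Λ H : Type*} [NormedAddCommGroup H] [InnerProductSpace ℂ H] [CompleteSpace H]

lemma _root_.BlockState.posTrace_ne_top (ρ : BlockState Λ H) (j : Λ) :
    posTrace (ρ.block j) ≠ ∞ :=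
  ne_top_of_le_ne_top ENNReal.one_ne_top (ρ.tsum_posTrace ▸ ENNReal.le_tsum j)

lemma hasSum_norm_sq (W : OpenQRW Λ H) (j : Λ) (v : H) :
    HasSum (fun i => ‖W.B i j v‖ ^ 2) (‖v‖ ^ 2) := by
  have h := (innerSL ℂ v).hasSum (W.hasSum_star_mul_self j v)
  have h' := Complex.reCLM.hasSum h
  simp only [Complex.reCLM_apply, innerSL_apply_apply, mul_apply_eq_comp,
    ContinuousLinearMap.star_eq_adjoint, ContinuousLinearMap.adjoint_inner_right,
    ← RCLike.re_eq_complex_re, ← norm_sq_eq_re_inner] at h'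
  exact h'

lemma tsum_posTrace_conj (W : OpenQRW Λ H) (j : Λ) {T : H →L[ℂ] H} (hT : T.IsPositive) :
    ∑' i, posTrace (W.B i j * T * star (W.B i j)) = posTrace T := by
  obtain ⟨S, h1, h2⟩ := posTrace_conj_eq hT
  rw [h1]
  simp only [h2, hs]
  rw [ENNReal.tsum_comm]
  refine tsum_congr fun k => ?_
  have h := W.hasSum_norm_sq j (star S (onb H k))
  have h3 := ENNReal.ofReal_tsum_of_nonneg (fun i => sq_nonneg _) h.summable
  rw [h.tsum_eq] at h3
  simpa [ENNReal.ofReal_pow] using h3.symm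

lemma isPositive_conj (W : OpenQRW Λ H) (ρ : BlockState Λ H) (i j : Λ) :
    (W.B i j * ρ.block j * star (W.B i j)).IsPositive :=
  (ρ.isPositive j).conj_adjoint (W.B i j)

lemma tsum_tsum_posTrace (W : OpenQRW Λ H) (ρ : BlockState Λ H) :
    ∑' i, ∑' j, posTrace (W.B i j * ρ.block j * star (W.B i j)) = 1 := by
  rw [ENNReal.tsum_comm]
  simp only [W.tsum_posTrace_conj _ (ρ.isPositive _), ρ.tsum_posTrace]

lemma summable_conj (W : OpenQRW Λ H) (ρ : BlockState Λ H) (i : Λ) :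
    Summable fun j => W.B i j * ρ.block j * star (W.B i j) := by
  have h : ∑' j, posTrace (W.B i j * ρ.block j * star (W.B i j)) ≠ ∞ :=
    ne_top_of_le_ne_top (by rw [tsum_tsum_posTrace W ρ]; simp)
      (ENNReal.le_tsum (f := fun i => ∑' j, posTrace (W.B i j * ρ.block j * star (W.B i j))) i)
  refine Summable.of_norm_bounded (ENNReal.summable_toReal h) fun j => ?_
  have := ENNReal.toReal_mono (ENNReal.ne_top_of_tsum_ne_top h j)
    (opNorm_le_posTrace (isPositive_conj W ρ i j))
  simpa using this

/-- One step `ρ ↦ 𝓜(ρ)` of the walk: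
`𝓜(ρ) = ∑ᵢ (∑ⱼ B i j ρⱼ (B i j)⋆) ⊗ |i⟩⟨i|`. -/
def step (W : OpenQRW Λ H) (ρ : BlockState Λ H) : BlockState Λ H where
  block i := ∑' j, W.B i j * ρ.block j * star (W.B i j)
  isPositive i := by
    rw [← ContinuousLinearMap.nonneg_iff_isPositive]
    exact tsum_nonneg fun j =>
      (ContinuousLinearMap.nonneg_iff_isPositive _).2 (isPositive_conj W ρ i j)
  tsum_posTrace := by
    rw [← tsum_tsum_posTrace W ρ]
    refine tsum_congr fun i => ?_
    simp only [posTrace]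
    rw [ENNReal.tsum_comm]
    refine tsum_congr fun k => ?_
    have h := (W.summable_conj ρ i).hasSum
    have h1 := (Complex.reCLM.comp (((innerSL ℂ (onb H k)).comp
      (ContinuousLinearMap.apply ℂ H (onb H k))).restrictScalars ℝ)).hasSum h
    simp only [ContinuousLinearMap.coe_comp, ContinuousLinearMap.coe_restrictScalars',
      Function.comp_apply, Complex.reCLM_apply] at h1
    have h2 := ENNReal.ofReal_tsum_of_nonneg
      (fun j => (isPositive_conj W ρ i j).re_inner_nonneg_right (onb H k)) h1.summable
    exact (congrArg ENNReal.ofReal h1.tsum_eq.symm).trans h2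

/-- The state `ρ⁽ⁿ⁾ = 𝓜ⁿ(ρ⁽⁰⁾)` of the walk at time `n`. -/
def stateAt (W : OpenQRW Λ H) (ρ₀ : BlockState Λ H) (n : ℕ) : BlockState Λ H := W.step^[n] ρ₀

end OpenQRW

/-! ### The algebra of block-diagonal observables -/

/-- The Hilbert space `H ⊗ K`, where `K = ℓ²(Λ)`, realised as `ℓ²(Λ; H)`. -/
abbrev SiteSpace (Λ H : Type*) [NormedAddCommGroup H] [InnerProductSpace ℂ H] : Type _ :=
  lp (fun _ : Λ => H) 2

namespace SiteSpace

variable {Λ H : Type*} [NormedAddCommGroup H] [InnerProductSpace ℂ H] [CompleteSpace H]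

open scoped Classical in
/-- The isometry `v ↦ v ⊗ |j⟩`. -/
def inj (j : Λ) : H →L[ℂ] SiteSpace Λ H := lp.singleContinuousLinearMap ℂ (fun _ : Λ => H) 2 j

/-- The coordinate map `I ⊗ ⟨j|`, adjoint to `inj j`. -/
def coord (j : Λ) : SiteSpace Λ H →L[ℂ] H := lp.evalCLM ℂ (fun _ : Λ => H) 2 j

/-- The operator `a ⊗ |i⟩⟨j|`. -/
def elem (i j : Λ) (a : H →L[ℂ] H) : SiteSpace Λ H →L[ℂ] SiteSpace Λ H :=
  (inj i).comp (a.comp (coord j))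

/-- The `(j, j)` block `x(j)` of an operator `x` on `H ⊗ K`. -/
def blockAt (x : SiteSpace Λ H →L[ℂ] SiteSpace Λ H) (j : Λ) : H →L[ℂ] H :=
  (coord j).comp (x.comp (inj j))

@[simp] lemma coord_apply (j : Λ) (v : SiteSpace Λ H) : coord j v = v j := rfl

lemma inj_apply_self (j : Λ) (v : H) : (inj j v : SiteSpace Λ H) j = v := by
  classical
  simp [inj]

lemma inj_apply_ne {i j : Λ} (h : i ≠ j) (v : H) : (inj j v : SiteSpace Λ H) i = 0 := by
  classical
  simp [inj, h]

lemma inner_inj (j : Λ) (v : H) (w : SiteSpace Λ H) : ⟪inj j v, w⟫_ℂ = ⟪v, w j⟫_ℂ := by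
  classical
  simp [inj, lp.inner_single_left]

lemma star_elem (i j : Λ) (a : H →L[ℂ] H) :
    star (elem i j a : SiteSpace Λ H →L[ℂ] SiteSpace Λ H) = elem j i (star a) := by
  rw [ContinuousLinearMap.star_eq_adjoint, eq_comm, ContinuousLinearMap.eq_adjoint_iff]
  intro v w
  simp only [elem, ContinuousLinearMap.comp_apply, coord_apply, inner_inj]
  rw [← inner_conj_symm v, inner_inj, inner_conj_symm, ContinuousLinearMap.star_eq_adjoint,
    ContinuousLinearMap.adjoint_inner_left]

lemma elem_mul_elem (i j k : Λ) (a b : H →L[ℂ] H) :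
    (elem i j a * elem j k b : SiteSpace Λ H →L[ℂ] SiteSpace Λ H) = elem i k (a * b) := by
  ext1 v
  simp [elem, inj_apply_self]

lemma elem_mul_elem_ne {i j j' k : Λ} (h : j ≠ j') (a b : H →L[ℂ] H) :
    (elem i j a * elem j' k b : SiteSpace Λ H →L[ℂ] SiteSpace Λ H) = 0 := by
  ext1 v
  simp [elem, inj_apply_ne h]

variable (Λ H) in
/-- The algebra `𝓑` of bounded block-diagonal operators `∑ⱼ x(j) ⊗ |j⟩⟨j|` on `H ⊗ K`: the
commutant of the projections `I ⊗ |j⟩⟨j|`, a von Neumann algebra. -/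
def blockAlgebra : StarSubalgebra ℂ (SiteSpace Λ H →L[ℂ] SiteSpace Λ H) :=
  StarSubalgebra.centralizer ℂ (Set.range fun j : Λ => elem j j (1 : H →L[ℂ] H))

lemma mem_blockAlgebra_iff {x : SiteSpace Λ H →L[ℂ] SiteSpace Λ H} :
    x ∈ blockAlgebra Λ H ↔
      ∀ j : Λ, elem j j (1 : H →L[ℂ] H) * x = x * elem j j (1 : H →L[ℂ] H) := by
  simp [blockAlgebra, StarSubalgebra.mem_centralizer_iff, star_elem]

lemma mem_blockAlgebra_iff_apply {x : SiteSpace Λ H →L[ℂ] SiteSpace Λ H} :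
    x ∈ blockAlgebra Λ H ↔ ∀ v j, x v j = blockAt x j (v j) := by
  rw [mem_blockAlgebra_iff]
  constructor
  · intro h v j
    have := congrArg (fun T : SiteSpace Λ H →L[ℂ] SiteSpace Λ H => T v j) (h j)
    simpa [elem, inj_apply_self, blockAt] using this
  · intro h j
    ext1 v
    ext i
    by_cases hij : i = j
    · subst hij
      simp [elem, inj_apply_self, h v, blockAt]
    · rw [mul_apply_eq_comp, mul_apply_eq_comp, h (elem j j 1 v)]
      simp [elem, inj_apply_ne hij]

variable (Λ H) in
/-- The algebra `𝓑₀` of operators `∑ⱼ a(j) ⊗ |j⟩⟨j|` with `∑ⱼ ‖a(j)‖ < ∞`. -/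
def summableBlocks : Set (SiteSpace Λ H →L[ℂ] SiteSpace Λ H) :=
  {x | ∃ a : Λ → (H →L[ℂ] H), Summable (fun j => ‖a j‖) ∧ ∀ v j, x v j = a j (v j)}

/-- `𝓑` is the closure of `𝓑₀` in the weak operator topology. -/
theorem closure_summableBlocks :
    closure (ContinuousLinearMapWOT.ofCLM '' summableBlocks Λ H) =
      ContinuousLinearMapWOT.ofCLM (σ := RingHom.id ℂ) ''
        (blockAlgebra Λ H : Set (SiteSpace Λ H →L[ℂ] SiteSpace Λ H)) := by
  classical
  apply subset_antisymm
  · refine closure_minimal (Set.image_mono ?_) ?_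
    · rintro x ⟨a, -, hx⟩
      rw [SetLike.mem_coe, mem_blockAlgebra_iff_apply]
      intro v j
      simp [blockAt, hx, inj_apply_self]
    · have : ContinuousLinearMapWOT.ofCLM (σ := RingHom.id ℂ) ''
          (blockAlgebra Λ H : Set (SiteSpace Λ H →L[ℂ] SiteSpace Λ H)) =
          ⋂ j : Λ, {x | ContinuousLinearMapWOT.ofCLM (elem j j (1 : H →L[ℂ] H)) * x =
            x * ContinuousLinearMapWOT.ofCLM (elem j j (1 : H →L[ℂ] H))} := by
        ext x
        obtain ⟨x, rfl⟩ := ContinuousLinearMapWOT.ofCLM_surjective x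
        rw [ContinuousLinearMapWOT.ofCLM_injective.mem_set_image, SetLike.mem_coe,
          mem_blockAlgebra_iff]
        simp only [Set.mem_iInter, Set.mem_ofPred_eq, ← ContinuousLinearMapWOT.ofCLM_mul]
        exact forall_congr' fun j => ContinuousLinearMapWOT.ofCLM_injective.eq_iff.symm
      rw [this]
      exact isClosed_iInter fun j => isClosed_eq
        (ContinuousLinearMapWOT.continuous_postcomp _)
        (ContinuousLinearMapWOT.continuous_precomp _)
  · rintro _ ⟨x, hx, rfl⟩
    rw [SetLike.mem_coe, mem_blockAlgebra_iff_apply] at hx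
    have hsum : ∀ w : SiteSpace Λ H, HasSum (fun j => inj j (w j)) w := fun w => by
      simpa [inj] using lp.hasSum_single (p := 2) (by simp) w
    refine mem_closure_of_tendsto (f := fun s : Finset Λ =>
      ContinuousLinearMapWOT.ofCLM (∑ j ∈ s, elem j j (blockAt x j))) (b := atTop) ?_ ?_
    · rw [ContinuousLinearMapWOT.tendsto_iff_forall_inner_apply_tendsto]
      intro v w
      have h1 := (innerSL ℂ w).hasSum (hsum (x v))
      refine h1.congr fun s => ?_
      simp [elem, hx v, inner_sum]
    · refine Eventually.of_forall fun s => ⟨_, ⟨fun j => if j ∈ s then blockAt x j else 0, ?_, ?_⟩,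
        rfl⟩
      · refine summable_of_ne_finset_zero (s := s) fun j hj => ?_
        simp [hj]
      · intro v j
        have e : ∀ i, (elem i i (blockAt x i) v : SiteSpace Λ H) j =
            if i = j then blockAt x j (v j) else 0 := by
          intro i
          split_ifs with h
          · subst h
            simp [elem, inj_apply_self]
          · simp [elem, inj_apply_ne (Ne.symm h)]
        have e2 : ((∑ i ∈ s, elem i i (blockAt x i)) v : SiteSpace Λ H) j =
            ∑ i ∈ s, (elem i i (blockAt x i) v : SiteSpace Λ H) j := by
          rw [sum_apply, lp.coeFn_sum, Finset.sum_apply]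
        rw [e2]
        simp only [e, Finset.sum_ite_eq']
        split_ifs <;> rfl

end SiteSpace

/-! ### Quantum Markov chains -/

namespace QMC

variable {G : Type*} [NormedAddCommGroup G] [InnerProductSpace ℂ G] [CompleteSpace G]
variable {𝓑 : StarSubalgebra ℂ (G →L[ℂ] G)}

/-- The nested expression
`𝓔⁽ᵏ⁾(aₖ ⊗ 𝓔⁽ᵏ⁺¹⁾(aₖ₊₁ ⊗ ⋯ 𝓔⁽ᵏ⁺ᵐ⁻¹⁾(aₖ₊ₘ₋₁ ⊗ y)))` with `m` transition expectations, where
`E k x y` stands for `𝓔⁽ᵏ⁾(x ⊗ y)`. -/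
def nested (E : ℕ → 𝓑 →ₗ[ℂ] 𝓑 →ₗ[ℂ] 𝓑) (a : ℕ → 𝓑) : ℕ → ℕ → 𝓑 → 𝓑
  | _, 0, y => y
  | k, m + 1, y => E k (a k) (nested E a (k + 1) m y)

/-- `b` is the limit of the sequence `f` in the strong operator topology. The sequence is given by
its germ at infinity, since only its eventual values matter. -/
def IsStrongLimit (f : Germ (atTop : Filter ℕ) 𝓑) (b : 𝓑) : Prop :=
  ∀ v : G, (f.map fun x : 𝓑 => (x : G →L[ℂ] G) v).Tendsto (𝓝 ((b : G →L[ℂ] G) v))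

open scoped Classical in
/-- The strong limit of a sequence in `𝓑`, with value `0` if there is none. -/
def strongLimit (f : ℕ → 𝓑) : 𝓑 :=
  if h : ∃ b, IsStrongLimit (f : Germ atTop 𝓑) b then h.choose else 0

/-- `b̄(n) = limₖ 𝓔⁽ⁿ⁾(I ⊗ 𝓔⁽ⁿ⁺¹⁾(I ⊗ ⋯ ⊗ 𝓔⁽ⁿ⁺ᵏ⁾(I ⊗ I)))`. -/
def bbar (E : ℕ → 𝓑 →ₗ[ℂ] 𝓑 →ₗ[ℂ] 𝓑) (n : ℕ) : 𝓑 :=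
  strongLimit fun k => nested E 1 n (k + 1) 1

/-- `E₀](a₀ ⊗ ⋯ ⊗ aₙ ⊗ I ⊗ I ⊗ ⋯) = 𝓔⁽⁰⁾(a₀ ⊗ ⋯ 𝓔⁽ⁿ⁾(aₙ ⊗ b̄(n+1)))`; only the entries
`a 0, …, a n` of the sequence `a` are used. -/
def finiteExp (E : ℕ → 𝓑 →ₗ[ℂ] 𝓑 →ₗ[ℂ] 𝓑) (a : ℕ → 𝓑) (n : ℕ) : 𝓑 :=
  nested E a 0 (n + 1) (bbar E (n + 1))

variable (𝓑) in
/-- The (algebraic) infinite tensor product `𝓐 = ⨂_{i ∈ ℕ} 𝓑`. It is the algebra spanned by the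
elementary tensors `a₀ ⊗ a₁ ⊗ ⋯` with all `aᵢ ∈ 𝓑`, multiplied entrywise. It contains the local
algebras `𝓑 ⊗ ⋯ ⊗ 𝓑 ⊗ I ⊗ I ⊗ ⋯` and the infinite tensors `I ⊗ ⋯ ⊗ I ⊗ p ⊗ p ⊗ ⋯`. -/
abbrev InfTensor : Type _ := ⨂[ℂ] _ : ℕ, 𝓑

lemma nested_of_lt (E : ℕ → 𝓑 →ₗ[ℂ] 𝓑 →ₗ[ℂ] 𝓑) (a : ℕ → 𝓑) {i k : ℕ} (hi : i < k) (x : 𝓑)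
    (m : ℕ) (y : 𝓑) : nested E (Function.update a i x) k m y = nested E a k m y := by
  induction m generalizing k with
  | zero => rfl
  | succ m ih => simp only [nested, ih (Nat.lt_succ_of_lt hi), Function.update_of_ne hi.ne']

lemma nested_update_add (E : ℕ → 𝓑 →ₗ[ℂ] 𝓑 →ₗ[ℂ] 𝓑) (a : ℕ → 𝓑) (i k m : ℕ) (hk : k ≤ i)
    (hm : i < k + m) (x x' y : 𝓑) :
    nested E (Function.update a i (x + x')) k m y =
      nested E (Function.update a i x) k m y + nested E (Function.update a i x') k m y := by
  induction m generalizing k with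
  | zero => omega
  | succ m ih =>
    rcases hk.eq_or_lt with rfl | h
    · simp [nested, nested_of_lt]
    · simp [nested, ih (k + 1) h (by omega), h.ne]

lemma nested_update_smul (E : ℕ → 𝓑 →ₗ[ℂ] 𝓑 →ₗ[ℂ] 𝓑) (a : ℕ → 𝓑) (i k m : ℕ) (hk : k ≤ i)
    (hm : i < k + m) (c : ℂ) (x y : 𝓑) :
    nested E (Function.update a i (c • x)) k m y =
      c • nested E (Function.update a i x) k m y := by
  induction m generalizing k with
  | zero => omega
  | succ m ih =>
    rcases hk.eq_or_lt with rfl | h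
    · simp [nested, nested_of_lt]
    · simp [nested, ih (k + 1) h (by omega), h.ne]

/-- The linear map on `𝓐` that sends an elementary tensor `a = a₀ ⊗ a₁ ⊗ ⋯` to the (germ at
infinity of the) sequence `n ↦ E₀](a₀ ⊗ ⋯ ⊗ aₙ ⊗ I ⊗ I ⊗ ⋯)`. -/
def expGerm (E : ℕ → 𝓑 →ₗ[ℂ] 𝓑 →ₗ[ℂ] 𝓑) :
    InfTensor 𝓑 →ₗ[ℂ] Germ (atTop : Filter ℕ) 𝓑 :=
  PiTensorProduct.lift
    { toFun := fun a => (finiteExp E a : Germ atTop 𝓑)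
      map_update_add' := by
        intro dec a i x x'
        obtain rfl : dec = instDecidableEqNat := Subsingleton.elim _ _
        rw [← Germ.coe_add, Germ.coe_eq]
        filter_upwards [eventually_ge_atTop i] with n hn
        exact nested_update_add E a i 0 (n + 1) (Nat.zero_le _) (by omega) _ _ _
      map_update_smul' := by
        intro dec a i c x
        obtain rfl : dec = instDecidableEqNat := Subsingleton.elim _ _
        rw [← Germ.coe_smul, Germ.coe_eq]
        filter_upwards [eventually_ge_atTop i] with n hn
        exact nested_update_smul E a i 0 (n + 1) (Nat.zero_le _) (by omega) _ _ _ }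

lemma expGerm_tprod (E : ℕ → 𝓑 →ₗ[ℂ] 𝓑 →ₗ[ℂ] 𝓑) (a : ℕ → 𝓑) :
    expGerm E (PiTensorProduct.tprod ℂ a) = (finiteExp E a : Germ atTop 𝓑) :=
  PiTensorProduct.lift.tprod _

/-- `E₀](a) = e`, that is, `E₀](a)` is defined and equal to `e`: on elementary tensors,
`E₀](a) = limₙ E₀](a₀ ⊗ ⋯ ⊗ aₙ ⊗ I ⊗ I ⊗ ⋯)` in the strong operator topology. -/
def HasExp (E : ℕ → 𝓑 →ₗ[ℂ] 𝓑 →ₗ[ℂ] 𝓑) (a : InfTensor 𝓑) (e : 𝓑) : Prop :=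
  IsStrongLimit (expGerm E a) e

/-- `E₀](a)` is unique. -/
lemma HasExp.unique {E : ℕ → 𝓑 →ₗ[ℂ] 𝓑 →ₗ[ℂ] 𝓑} {a : InfTensor 𝓑} {e e' : 𝓑}
    (h : HasExp E a e) (h' : HasExp E a e') : e = e' := by
  unfold HasExp at h h'
  induction hf : expGerm E a using Germ.inductionOn with
  | h f =>
    rw [hf] at h h'
    ext v
    exact tendsto_nhds_unique (Germ.coe_tendsto.1 (h v)) (Germ.coe_tendsto.1 (h' v))

/-- `p_[n = I ⊗ ⋯ ⊗ I ⊗ p ⊗ p ⊗ ⋯`, with `p` in all places from the `n`th one on. -/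
def tailProj (p : 𝓑) (n : ℕ) : InfTensor 𝓑 :=
  PiTensorProduct.tprod ℂ fun k => if k < n then 1 else p

/-- `p_[n` is a reducing projection: `E₀](p_[n a p_[n) = E₀](a)` for all `a` (in the domain of
`E₀]`). -/
def IsReducing (E : ℕ → 𝓑 →ₗ[ℂ] 𝓑 →ₗ[ℂ] 𝓑) (p : 𝓑) (n : ℕ) : Prop :=
  ∀ (a : InfTensor 𝓑) (e : 𝓑), HasExp E a e → HasExp E (tailProj p n * a * tailProj p n) e

/-- The chain with transition expectations `E` is reducible: there are a projection `p ∈ 𝓑`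
different from `0` and `I`, and a time `n₀`, such that `p_[n₀` is reducing. -/
def IsReducible (E : ℕ → 𝓑 →ₗ[ℂ] 𝓑 →ₗ[ℂ] 𝓑) : Prop :=
  ∃ p : 𝓑, IsStarProjection p ∧ p ≠ 0 ∧ p ≠ 1 ∧ ∃ n₀ : ℕ, IsReducing E p n₀

/-- A chain is irreducible if it is not reducible. -/
def IsIrreducible (E : ℕ → 𝓑 →ₗ[ℂ] 𝓑 →ₗ[ℂ] 𝓑) : Prop := ¬ IsReducible E

end QMC

/-! ### The quantum Markov chain of an open quantum random walk -/

namespace OpenQRW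

open SiteSpace

variable {Λ H : Type*} [NormedAddCommGroup H] [InnerProductSpace ℂ H] [CompleteSpace H]

/-- `M i j = B i j ⊗ |i⟩⟨j|`. -/
def M (W : OpenQRW Λ H) (i j : Λ) : SiteSpace Λ H →L[ℂ] SiteSpace Λ H := elem i j (W.B i j)

/-- `Tr((ρⱼ ⊗ |j⟩⟨j|) x) / Tr(ρⱼ)`, and `0` if `ρⱼ = 0`. -/
def coeff (ρ : BlockState Λ H) (x : SiteSpace Λ H →L[ℂ] SiteSpace Λ H) (j : Λ) : ℂ :=
  open scoped Classical in
  if ρ.block j = 0 then 0 else trace (ρ.block j * blockAt x j) / trace (ρ.block j)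

lemma norm_blockAt_le (x : SiteSpace Λ H →L[ℂ] SiteSpace Λ H) (j : Λ) : ‖blockAt x j‖ ≤ ‖x‖ := by
  classical
  refine ContinuousLinearMap.opNorm_le_bound _ (norm_nonneg _) fun v => ?_
  refine (lp.norm_apply_le_norm (p := 2) (by simp) (x (inj j v)) j).trans ?_
  refine (x.le_opNorm _).trans_eq ?_
  simp [inj, lp.norm_single]

lemma trace_eq_posTrace {T : H →L[ℂ] H} (hT : T.IsPositive) :
    trace T = ((posTrace T).toReal : ℂ) := by
  unfold trace posTrace
  have h0 : ∀ k, 0 ≤ (⟪onb H k, T (onb H k)⟫_ℂ).re := fun k => hT.re_inner_nonneg_right _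
  have h1 : ∀ k, ⟪onb H k, T (onb H k)⟫_ℂ = ((⟪onb H k, T (onb H k)⟫_ℂ).re : ℂ) := by
    intro k
    have := hT.inner_nonneg_right (onb H k)
    exact (Complex.eq_re_of_ofReal_le this)
  rw [ENNReal.tsum_toReal_eq fun k => ENNReal.ofReal_ne_top, tsum_congr h1]
  simp only [ENNReal.toReal_ofReal (h0 _)]
  exact (Complex.ofReal_tsum _).symm

lemma norm_coeff_le (ρ : BlockState Λ H) (x : SiteSpace Λ H →L[ℂ] SiteSpace Λ H) (j : Λ) :
    ‖coeff ρ x j‖ ≤ ‖x‖ + 1 := by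
  unfold coeff
  split_ifs
  · simp; positivity
  have h := (summable_trace (ρ.isPositive j) (ρ.posTrace_ne_top j) (blockAt x j)).2
  rw [trace_eq_posTrace (ρ.isPositive j), norm_div, Complex.norm_real,
    Real.norm_of_nonneg ENNReal.toReal_nonneg]
  refine div_le_of_le_mul₀ ENNReal.toReal_nonneg (by positivity) (h.trans ?_)
  gcongr
  exact norm_blockAt_le x j

lemma coeff_add (ρ : BlockState Λ H) (x x' : SiteSpace Λ H →L[ℂ] SiteSpace Λ H) (j : Λ) :
    coeff ρ (x + x') j = coeff ρ x j + coeff ρ x' j := by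
  unfold coeff
  split_ifs
  · simp
  rw [← add_div]
  congr 1
  have e : blockAt (x + x') j = blockAt x j + blockAt x' j := by
    simp [blockAt]
  unfold trace
  rw [← Summable.tsum_add (summable_trace (ρ.isPositive j) (ρ.posTrace_ne_top j) _).1
    (summable_trace (ρ.isPositive j) (ρ.posTrace_ne_top j) _).1]
  simp [e, mul_add]

lemma coeff_smul (ρ : BlockState Λ H) (c : ℂ) (x : SiteSpace Λ H →L[ℂ] SiteSpace Λ H) (j : Λ) :
    coeff ρ (c • x) j = c * coeff ρ x j := by
  unfold coeff
  split_ifs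
  · simp
  rw [← mul_div_assoc]
  congr 1
  have e : blockAt (c • x) j = c • blockAt x j := by
    simp [blockAt]
  unfold trace
  rw [← tsum_mul_left]
  simp [e]

lemma hasSum_norm_M (W : OpenQRW Λ H) (v : SiteSpace Λ H) :
    Summable (fun q : Λ × Λ => ‖W.M q.2 q.1 v‖ ^ 2) ∧
      ∑' q : Λ × Λ, ‖W.M q.2 q.1 v‖ ^ 2 = ‖v‖ ^ 2 := by
  classical
  have e : ∀ i j : Λ, ‖W.M i j v‖ ^ 2 = ‖W.B i j (v j)‖ ^ 2 := by
    intro i j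
    simp [M, elem, inj, lp.norm_single]
  have hv : HasSum (fun j => ‖v j‖ ^ 2) (‖v‖ ^ 2) := by
    simpa using lp.hasSum_norm (p := 2) (by simp) v
  have hs : Summable (fun q : Λ × Λ => ‖W.M q.2 q.1 v‖ ^ 2) := by
    rw [summable_prod_of_nonneg fun q => sq_nonneg _]
    simp only [e, (W.hasSum_norm_sq _ _).tsum_eq]
    exact ⟨fun j => (W.hasSum_norm_sq j (v j)).summable, hv.summable⟩
  refine ⟨hs, ?_⟩
  rw [hs.tsum_prod]
  simp only [e, (W.hasSum_norm_sq _ _).tsum_eq, hv.tsum_eq]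

lemma norm_sum_le (W : OpenQRW Λ H) (s : Finset (Λ × Λ)) (w : Λ × Λ → SiteSpace Λ H) :
    ‖∑ q ∈ s, star (W.M q.2 q.1) (w q)‖ ^ 2 ≤ ∑ q ∈ s, ‖w q‖ ^ 2 := by
  set u := ∑ q ∈ s, star (W.M q.2 q.1) (w q) with hu
  have h1 : ‖u‖ ^ 2 ≤ ∑ q ∈ s, ‖W.M q.2 q.1 u‖ * ‖w q‖ := by
    have e : (‖u‖ ^ 2 : ℝ) = ‖⟪u, u⟫_ℂ‖ := by
      rw [inner_self_eq_norm_sq_to_K]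
      simp
    rw [e]
    nth_rw 2 [hu]
    rw [inner_sum]
    refine (_root_.norm_sum_le _ _).trans (Finset.sum_le_sum fun q _ => ?_)
    rw [ContinuousLinearMap.star_eq_adjoint, ContinuousLinearMap.adjoint_inner_right]
    exact norm_inner_le_norm _ _
  have h2 : (∑ q ∈ s, ‖W.M q.2 q.1 u‖ * ‖w q‖) ^ 2 ≤
      (∑ q ∈ s, ‖W.M q.2 q.1 u‖ ^ 2) * ∑ q ∈ s, ‖w q‖ ^ 2 := Finset.sum_mul_sq_le_sq_mul_sq _ _ _
  have h3 : ∑ q ∈ s, ‖W.M q.2 q.1 u‖ ^ 2 ≤ ‖u‖ ^ 2 := by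
    rw [← (W.hasSum_norm_M u).2]
    exact (W.hasSum_norm_M u).1.sum_le_tsum s fun _ _ => sq_nonneg _
  have hw : 0 ≤ ∑ q ∈ s, ‖w q‖ ^ 2 := Finset.sum_nonneg fun _ _ => sq_nonneg _
  have hu0 : 0 ≤ ‖u‖ ^ 2 := sq_nonneg _
  rcases hu0.eq_or_lt with h | h
  · rw [← h]; exact hw
  · have : ‖u‖ ^ 2 * ‖u‖ ^ 2 ≤ ‖u‖ ^ 2 * ∑ q ∈ s, ‖w q‖ ^ 2 := by nlinarith
    exact le_of_mul_le_mul_left this h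

/-- The `(j, i)` term of the transition expectation, applied to a vector. -/
def term (W : OpenQRW Λ H) (ρ : BlockState Λ H) (x y : SiteSpace Λ H →L[ℂ] SiteSpace Λ H)
    (q : Λ × Λ) : SiteSpace Λ H →L[ℂ] SiteSpace Λ H :=
  coeff ρ x q.1 • (star (W.M q.2 q.1) * y * W.M q.2 q.1)

lemma norm_sum_term_le (W : OpenQRW Λ H) (ρ : BlockState Λ H)
    (x y : SiteSpace Λ H →L[ℂ] SiteSpace Λ H) (v : SiteSpace Λ H) (s : Finset (Λ × Λ)) :
    ‖∑ q ∈ s, W.term ρ x y q v‖ ^ 2 ≤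
      ((‖x‖ + 1) * ‖y‖) ^ 2 * ∑ q ∈ s, ‖W.M q.2 q.1 v‖ ^ 2 := by
  have e : ∀ q, W.term ρ x y q v =
      star (W.M q.2 q.1) (coeff ρ x q.1 • y (W.M q.2 q.1 v)) := by
    intro q
    simp [term]
  simp only [e]
  refine (W.norm_sum_le s _).trans ?_
  rw [Finset.mul_sum]
  refine Finset.sum_le_sum fun q _ => ?_
  rw [← mul_pow, norm_smul, mul_assoc]
  gcongr
  · exact norm_coeff_le ρ x q.1
  · exact y.le_opNorm _

lemma summable_term (W : OpenQRW Λ H) (ρ : BlockState Λ H)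
    (x y : SiteSpace Λ H →L[ℂ] SiteSpace Λ H) (v : SiteSpace Λ H) :
    Summable fun q => W.term ρ x y q v := by
  rw [summable_iff_vanishing_norm]
  intro ε hε
  obtain ⟨s, hs⟩ := summable_iff_vanishing_norm.1
    ((W.hasSum_norm_M v).1.mul_left (((‖x‖ + 1) * ‖y‖) ^ 2)) (ε ^ 2) (by positivity)
  refine ⟨s, fun t ht => ?_⟩
  have h := (le_abs_self _).trans_lt (hs t ht)
  rw [← Finset.mul_sum] at h
  exact lt_of_pow_lt_pow_left₀ 2 hε.le ((W.norm_sum_term_le ρ x y v t).trans_lt h)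

lemma norm_tsum_term_le (W : OpenQRW Λ H) (ρ : BlockState Λ H)
    (x y : SiteSpace Λ H →L[ℂ] SiteSpace Λ H) (v : SiteSpace Λ H) :
    ‖∑' q, W.term ρ x y q v‖ ≤ ((‖x‖ + 1) * ‖y‖) * ‖v‖ := by
  refine le_of_tendsto ((W.summable_term ρ x y v).hasSum.norm) (Eventually.of_forall fun s => ?_)
  refine le_of_sq_le_sq ?_ (by positivity)
  refine (W.norm_sum_term_le ρ x y v s).trans ?_
  rw [mul_pow _ ‖v‖, ← (W.hasSum_norm_M v).2]
  gcongr
  exact (W.hasSum_norm_M v).1.sum_le_tsum s fun _ _ => sq_nonneg _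

/-- The bounded operator
`∑_{j : ρⱼ ≠ 0} ∑ᵢ (Tr((ρⱼ ⊗ |j⟩⟨j|) x) / Tr ρⱼ) (M i j)⋆ y (M i j)`, a strongly convergent
series. -/
def transOp (W : OpenQRW Λ H) (ρ : BlockState Λ H) (x y : SiteSpace Λ H →L[ℂ] SiteSpace Λ H) :
    SiteSpace Λ H →L[ℂ] SiteSpace Λ H :=
  LinearMap.mkContinuous
    { toFun := fun v => ∑' q : Λ × Λ, W.term ρ x y q v
      map_add' := fun v v' => by
        rw [← (W.summable_term ρ x y v).tsum_add (W.summable_term ρ x y v')]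
        simp
      map_smul' := fun c v => by
        rw [RingHom.id_apply, ← (W.summable_term ρ x y v).tsum_const_smul]
        simp }
    ((‖x‖ + 1) * ‖y‖) fun v => W.norm_tsum_term_le ρ x y v

lemma transOp_apply (W : OpenQRW Λ H) (ρ : BlockState Λ H)
    (x y : SiteSpace Λ H →L[ℂ] SiteSpace Λ H) (v : SiteSpace Λ H) :
    W.transOp ρ x y v = ∑' q : Λ × Λ,
      coeff ρ x q.1 • (star (W.M q.2 q.1) * y * W.M q.2 q.1) v := rfl

lemma term_comm (W : OpenQRW Λ H) (ρ : BlockState Λ H)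
    (x y : SiteSpace Λ H →L[ℂ] SiteSpace Λ H) (q : Λ × Λ) (l : Λ) :
    elem l l (1 : H →L[ℂ] H) * W.term ρ x y q = W.term ρ x y q * elem l l (1 : H →L[ℂ] H) := by
  have h1 : star (W.M q.2 q.1) = elem q.1 q.2 (star (W.B q.2 q.1)) := star_elem _ _ _
  by_cases h : l = q.1
  · subst h
    have e1 : elem q.1 q.1 (1 : H →L[ℂ] H) * star (W.M q.2 q.1) = star (W.M q.2 q.1) := by
      rw [h1, elem_mul_elem, one_mul]
    have e2 : W.M q.2 q.1 * elem q.1 q.1 (1 : H →L[ℂ] H) = W.M q.2 q.1 := by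
      rw [M, elem_mul_elem, mul_one]
    rw [term, mul_smul_comm, smul_mul_assoc, ← mul_assoc, ← mul_assoc, e1,
      mul_assoc _ (W.M q.2 q.1), e2]
  · have e1 : elem l l (1 : H →L[ℂ] H) * star (W.M q.2 q.1) = 0 := by
      rw [h1, elem_mul_elem_ne h]
    have e2 : W.M q.2 q.1 * elem l l (1 : H →L[ℂ] H) = 0 := by
      rw [M, elem_mul_elem_ne (Ne.symm h)]
    rw [term, mul_smul_comm, smul_mul_assoc, ← mul_assoc, ← mul_assoc, e1,
      mul_assoc _ (W.M q.2 q.1), e2]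
    simp

lemma transOp_mem (W : OpenQRW Λ H) (ρ : BlockState Λ H)
    (x y : SiteSpace Λ H →L[ℂ] SiteSpace Λ H) : W.transOp ρ x y ∈ blockAlgebra Λ H := by
  rw [mem_blockAlgebra_iff]
  intro l
  ext1 v
  change elem l l (1 : H →L[ℂ] H) (∑' q, W.term ρ x y q v) =
    ∑' q, W.term ρ x y q (elem l l (1 : H →L[ℂ] H) v)
  rw [ContinuousLinearMap.map_tsum _ (W.summable_term ρ x y v)]
  exact tsum_congr fun q => congrArg (fun T : SiteSpace Λ H →L[ℂ] SiteSpace Λ H => T v)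
    (W.term_comm ρ x y q l)

/-- The transition expectation of the walk in the state `ρ`, for `x, y ∈ 𝓑`:
`𝓔(x ⊗ y) = ∑_{j : ρⱼ ≠ 0} ∑ᵢ (Tr((ρⱼ ⊗ |j⟩⟨j|) x) / Tr ρⱼ) (M i j)⋆ y (M i j)`. -/
def transExp (W : OpenQRW Λ H) (ρ : BlockState Λ H) :
    blockAlgebra Λ H →ₗ[ℂ] blockAlgebra Λ H →ₗ[ℂ] blockAlgebra Λ H :=
  LinearMap.mk₂ ℂ (fun x y => ⟨W.transOp ρ x y, W.transOp_mem ρ x y⟩)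
    (fun x x' y => by
      ext1; ext1 v
      change ∑' q, W.term ρ (x + x') y q v = ∑' q, W.term ρ x y q v + ∑' q, W.term ρ x' y q v
      rw [← (W.summable_term ρ x y v).tsum_add (W.summable_term ρ x' y v)]
      simp [term, coeff_add, add_smul])
    (fun c x y => by
      ext1; ext1 v
      change ∑' q, W.term ρ (c • x) y q v = c • ∑' q, W.term ρ x y q v
      rw [← (W.summable_term ρ x y v).tsum_const_smul]
      simp [term, coeff_smul, mul_smul])
    (fun x y y' => by
      ext1; ext1 v
      change ∑' q, W.term ρ x (y + y') q v = ∑' q, W.term ρ x y q v + ∑' q, W.term ρ x y' q v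
      rw [← (W.summable_term ρ x y v).tsum_add (W.summable_term ρ x y' v)]
      simp [term])
    (fun c x y => by
      ext1; ext1 v
      change ∑' q, W.term ρ x (c • y) q v = c • ∑' q, W.term ρ x y q v
      rw [← (W.summable_term ρ x y v).tsum_const_smul]
      simp [term, smul_comm c])

/-- The transition expectations `𝓔⁽ⁿ⁾` of the nonhomogeneous quantum Markov chain
`(ρ⁽⁰⁾, (𝓔⁽ⁿ⁾)ₙ)` associated with the walk with initial state `ρ⁽⁰⁾`: `𝓔⁽ⁿ⁾` is the transition
expectation of the walk in the state `ρ⁽ⁿ⁾`. -/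
def qmc (W : OpenQRW Λ H) (ρ₀ : BlockState Λ H) :
    ℕ → blockAlgebra Λ H →ₗ[ℂ] blockAlgebra Λ H →ₗ[ℂ] blockAlgebra Λ H :=
  fun n => W.transExp (W.stateAt ρ₀ n)

end OpenQRW

end

/-! Irreducibility is read off from the single element `a = I ⊗ I ⊗ ⋯`. Faithfulness makes every
ρ⁽ⁿ⁾ⱼ nonzero, so no site is dropped from the sum defining 𝓔⁽ⁿ⁾ and 𝓔⁽ⁿ⁾(I ⊗ I) = I. Hence b̄(n) = I
and E₀](I) = I, and a reducing p would force the truncated expectations of `p_[n₀` to converge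
strongly to I.

This is impossible unless p = I. From I - 𝓔(x ⊗ y) = 𝓔((I - x) ⊗ I) + 𝓔(x ⊗ (I - y)) and positivity,
every truncation falls short of I by at least X = 𝓔⁽⁰⁾(I ⊗ ⋯ 𝓔⁽ⁿ⁰⁾((I - p) ⊗ I)), which does not
depend on the truncation (`nested_le_one_sub_finiteExp_tail`). In the limit X = 0, and two separate
faithfulness properties of 𝓔⁽ⁿ⁾ lead from X = 0 to I - p = 0.

Second argument: if 𝓔⁽ⁿ⁾(I ⊗ y) = 0 with y ≥ 0, then y(i) kills the range of every B i j, so y(i)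
ρ⁽ⁿ⁺¹⁾ᵢ = 0, and faithfulness at time n + 1 gives y(i) = 0 (`blockAt_eq_zero_of_one_transOp`). This
strips the outer n₀ layers of X. First argument: if 𝓔⁽ⁿ⁾(x ⊗ I) = 0 with x ≥ 0, then Tr(ρ⁽ⁿ⁾ⱼ x(j))
= 0 because the B i j with j fixed cannot all vanish, and faithfulness at time n gives x(j) = 0
(`blockAt_eq_zero_of_transOp_one`). This disposes of the innermost layer. -/

section

open Filter Topology
open scoped InnerProductSpace ENNReal

set_option linter.unusedSectionVars false

open HilbertTrace

/-! ### Positivity of the trace pairing, and consequences of faithfulness. -/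

namespace HilbertTrace

variable {H : Type*} [NormedAddCommGroup H] [InnerProductSpace ℂ H] [CompleteSpace H]

lemma hs_eq_tsum_inner (A : H →L[ℂ] H) :
    hs A = ∑' q : onbIndex H × onbIndex H, ‖⟪onb H q.2, A (onb H q.1)⟫_ℂ‖ₑ ^ 2 := by
  rw [ENNReal.tsum_prod (f := fun k l => ‖⟪onb H l, A (onb H k)⟫_ℂ‖ₑ ^ 2)]
  exact tsum_congr fun k => enorm_sq_eq _

lemma summable_inner_sq {A : H →L[ℂ] H} (h : hs A ≠ ∞) :
    Summable fun q : onbIndex H × onbIndex H => ‖⟪onb H q.2, A (onb H q.1)⟫_ℂ‖ ^ 2 := by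
  rw [hs_eq_tsum_inner] at h
  simpa using ENNReal.summable_toReal h

lemma mul_le_sq_add_sq (a b : ℝ) : a * b ≤ a ^ 2 + b ^ 2 := by
  nlinarith [sq_nonneg (a - b), sq_nonneg a, sq_nonneg b]

/-- Absolute convergence of the double series of matrix coefficients, which licenses the interchange
of sums behind the cyclicity of the trace. -/
lemma summable_inner_mul_inner {A B : H →L[ℂ] H} (hA : hs A ≠ ∞) (hB : hs B ≠ ∞) :
    Summable fun q : onbIndex H × onbIndex H =>
      ⟪A (onb H q.1), onb H q.2⟫_ℂ * ⟪onb H q.2, B (onb H q.1)⟫_ℂ := by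
  refine Summable.of_norm_bounded ((summable_inner_sq hA).add (summable_inner_sq hB)) fun q => ?_
  rw [norm_mul, norm_inner_symm]
  exact mul_le_sq_add_sq _ _

/-- The Hilbert-Schmidt inner product satisfies `⟨A, B⟩ = ⟨B⋆, A⋆⟩`. -/
lemma tsum_inner_eq_tsum_inner_star {A B : H →L[ℂ] H} (hA : hs A ≠ ∞) (hB : hs B ≠ ∞) :
    ∑' k, ⟪A (onb H k), B (onb H k)⟫_ℂ = ∑' k, ⟪star B (onb H k), star A (onb H k)⟫_ℂ := by
  have h1 : ∀ k, ⟪A (onb H k), B (onb H k)⟫_ℂ =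
      ∑' l, ⟪A (onb H k), onb H l⟫_ℂ * ⟪onb H l, B (onb H k)⟫_ℂ := fun k =>
    ((onb H).tsum_inner_mul_inner (A (onb H k)) (B (onb H k))).symm
  have h2 : ∀ l, ⟪star B (onb H l), star A (onb H l)⟫_ℂ =
      ∑' k, ⟪A (onb H k), onb H l⟫_ℂ * ⟪onb H l, B (onb H k)⟫_ℂ := fun l => by
    rw [← (onb H).tsum_inner_mul_inner (star B (onb H l)) (star A (onb H l))]
    refine tsum_congr fun k => ?_
    rw [ContinuousLinearMap.star_eq_adjoint, ContinuousLinearMap.star_eq_adjoint,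
      ContinuousLinearMap.adjoint_inner_left, ContinuousLinearMap.adjoint_inner_right, mul_comm]
  rw [tsum_congr h1, tsum_congr h2]
  exact (Summable.tsum_comm (f := fun k l => ⟪A (onb H k), onb H l⟫_ℂ * ⟪onb H l, B (onb H k)⟫_ℂ)
    (summable_inner_mul_inner hA hB)).symm

open scoped ComplexOrder in
-- With T = S⋆S and a = R⋆R, Tr(Ta) is the Hilbert-Schmidt pairing of S with SR⋆R. Passing to
-- adjoints turns its terms into ‖R S⋆ eₖ‖².
lemma trace_mul_nonneg {T a : H →L[ℂ] H} (hT : T.IsPositive) (h : posTrace T ≠ ∞)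
    (ha : a.IsPositive) : 0 ≤ trace (T * a) := by
  obtain ⟨S, rfl⟩ := exists_factor hT
  obtain ⟨R, rfl⟩ := exists_factor ha
  rw [posTrace_star_mul_self] at h
  -- `hs_mul_le` needs the Hilbert-Schmidt factor on the right, hence the adjoint.
  have hB : hs (S * (star R * R)) ≠ ∞ := by
    rw [← hs_adjoint, star_mul]
    refine ne_top_of_le_ne_top ?_ (hs_mul_le _ _)
    rw [hs_adjoint]
    finiteness
  have e : trace (star S * S * (star R * R)) =
      ∑' k, ⟪S (onb H k), (S * (star R * R)) (onb H k)⟫_ℂ := by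
    refine tsum_congr fun k => ?_
    rw [mul_assoc, mul_apply_eq_comp (star S), ContinuousLinearMap.star_eq_adjoint S,
      ContinuousLinearMap.adjoint_inner_right]
  rw [e, tsum_inner_eq_tsum_inner_star h hB]
  refine tsum_nonneg fun k => ?_
  rw [star_mul, star_mul, star_star, mul_assoc, mul_apply_eq_comp,
    ContinuousLinearMap.star_eq_adjoint R, ContinuousLinearMap.adjoint_inner_left,
    mul_apply_eq_comp, inner_self_eq_norm_sq_to_K]
  positivity

open scoped ComplexOrder in
-- In the complex order, nonnegativity includes being real, and over ℂ a real quadratic form already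
-- forces self-adjointness.
lemma nonneg_iff_inner {T : H →L[ℂ] H} : 0 ≤ T ↔ ∀ v : H, 0 ≤ ⟪v, T v⟫_ℂ := by
  rw [ContinuousLinearMap.nonneg_iff_isPositive]
  refine ⟨fun h v => h.inner_nonneg_right v, fun h => ?_⟩
  rw [ContinuousLinearMap.isPositive_iff_complex]
  intro v
  obtain ⟨h1, h2⟩ := Complex.nonneg_iff.1 (h v)
  rw [← inner_conj_symm v, Complex.conj_re] at h1
  rw [← inner_conj_symm v, Complex.conj_im, zero_eq_neg] at h2
  refine ⟨Complex.ext rfl ?_, h1⟩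
  exact h2.symm

/-- For T = S⋆S the quadratic form at v is ‖Sv‖². -/
lemma apply_eq_zero_of_inner {T : H →L[ℂ] H} (hT : 0 ≤ T) {v : H} (h : ⟪v, T v⟫_ℂ = 0) :
    T v = 0 := by
  obtain ⟨S, rfl⟩ := CStarAlgebra.nonneg_iff_eq_star_mul_self.1 hT
  rw [mul_apply_eq_comp, ContinuousLinearMap.star_eq_adjoint,
    ContinuousLinearMap.adjoint_inner_right, inner_self_eq_zero] at h
  rw [mul_apply_eq_comp, h, map_zero]

lemma trace_smul (c : ℂ) (T : H →L[ℂ] H) : trace (c • T) = c * trace T := by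
  unfold trace
  rw [← tsum_mul_left]
  simp

/-- With the convention 0⁻¹ = 0, a vanishing trace would make the normalised operator zero, which
does not have trace one. -/
lemma IsFaithfulState.trace_ne_zero {T : H →L[ℂ] H}
    (h : IsFaithfulState ((trace T)⁻¹ • T)) : trace T ≠ 0 := by
  intro h0
  have := h.posTrace_eq_one
  simp [h0, posTrace] at this

lemma IsFaithfulState.eq_zero_of_trace_mul {T : H →L[ℂ] H}
    (h : IsFaithfulState ((trace T)⁻¹ • T)) {a : H →L[ℂ] H} (ha : a.IsPositive)
    (h0 : trace (T * a) = 0) : a = 0 :=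
  h.faithful a ha (by rw [smul_mul_assoc, trace_smul, h0, mul_zero])

end HilbertTrace

/-- Every block of `ρ`, normalised, is the density operator of a faithful state. -/
def BlockState.IsFaithful {Λ H : Type*} [NormedAddCommGroup H] [InnerProductSpace ℂ H]
    [CompleteSpace H] (ρ : BlockState Λ H) : Prop :=
  ∀ j, HilbertTrace.IsFaithfulState ((HilbertTrace.trace (ρ.block j))⁻¹ • ρ.block j)

/-! ### Blocks of positive operators. -/

namespace SiteSpace

variable {Λ H : Type*} [NormedAddCommGroup H] [InnerProductSpace ℂ H] [CompleteSpace H]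

lemma inner_blockAt (x : SiteSpace Λ H →L[ℂ] SiteSpace Λ H) (j : Λ) (u v : H) :
    ⟪u, blockAt x j v⟫_ℂ = ⟪inj j u, x (inj j v)⟫_ℂ := by
  rw [inner_inj]
  rfl

open scoped ComplexOrder in
lemma blockAt_nonneg {x : SiteSpace Λ H →L[ℂ] SiteSpace Λ H} (hx : 0 ≤ x) (j : Λ) :
    0 ≤ blockAt x j := by
  rw [nonneg_iff_inner] at hx ⊢
  intro v
  rw [inner_blockAt]
  exact hx _

lemma eq_zero_of_blockAt {x : blockAlgebra Λ H}
    (h : ∀ j, blockAt (x : SiteSpace Λ H →L[ℂ] SiteSpace Λ H) j = 0) : x = 0 := by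
  ext v j
  rw [mem_blockAlgebra_iff_apply.1 x.2 v j, h]
  rfl

end SiteSpace

/-! ### Unitality, positivity and faithfulness of the transition expectations. -/

namespace OpenQRW

open SiteSpace
open scoped ComplexOrder

variable {Λ H : Type*} [NormedAddCommGroup H] [InnerProductSpace ℂ H] [CompleteSpace H]

lemma coeff_nonneg (ρ : BlockState Λ H) {x : SiteSpace Λ H →L[ℂ] SiteSpace Λ H} (hx : 0 ≤ x)
    (j : Λ) : 0 ≤ coeff ρ x j := by
  unfold coeff
  split_ifs
  · rfl
  · refine div_nonneg (trace_mul_nonneg (ρ.isPositive j) (ρ.posTrace_ne_top j) ?_) ?_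
    · exact (ContinuousLinearMap.nonneg_iff_isPositive _).1 (blockAt_nonneg hx j)
    · rw [trace_eq_posTrace (ρ.isPositive j)]
      exact_mod_cast ENNReal.toReal_nonneg

lemma _root_.BlockState.IsFaithful.block_ne_zero {ρ : BlockState Λ H} (hρ : ρ.IsFaithful) (j : Λ) :
    ρ.block j ≠ 0 := by
  intro h
  apply (hρ j).trace_ne_zero
  simp [h, trace]

lemma blockAt_one (j : Λ) : blockAt (1 : SiteSpace Λ H →L[ℂ] SiteSpace Λ H) j = 1 := by
  ext v
  exact inj_apply_self j v

lemma coeff_one {ρ : BlockState Λ H} (hρ : ρ.IsFaithful) (j : Λ) : coeff ρ 1 j = 1 := by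
  rw [coeff, if_neg (hρ.block_ne_zero j), blockAt_one, mul_one, div_self (hρ j).trace_ne_zero]

lemma blockAt_eq_zero_of_coeff {ρ : BlockState Λ H} (hρ : ρ.IsFaithful)
    {x : SiteSpace Λ H →L[ℂ] SiteSpace Λ H} (hx : 0 ≤ x) {j : Λ} (h : coeff ρ x j = 0) :
    blockAt x j = 0 := by
  rw [coeff, if_neg (hρ.block_ne_zero j),
    div_eq_zero_iff, or_iff_left (hρ j).trace_ne_zero] at h
  exact (hρ j).eq_zero_of_trace_mul
    ((ContinuousLinearMap.nonneg_iff_isPositive _).1 (blockAt_nonneg hx j)) h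

lemma inner_term (W : OpenQRW Λ H) (ρ : BlockState Λ H)
    (x y : SiteSpace Λ H →L[ℂ] SiteSpace Λ H) (q : Λ × Λ) (v : SiteSpace Λ H) :
    ⟪v, W.term ρ x y q v⟫_ℂ =
      coeff ρ x q.1 * ⟪W.B q.2 q.1 (v q.1), blockAt y q.2 (W.B q.2 q.1 (v q.1))⟫_ℂ := by
  rw [inner_blockAt]
  simp only [term, smul_apply, inner_smul_right, mul_apply_eq_comp,
    ContinuousLinearMap.star_eq_adjoint, ContinuousLinearMap.adjoint_inner_right]
  rfl

/-- The quadratic form of 𝓔(x ⊗ y) as a scalar series. For x, y ≥ 0 its terms are nonnegative, so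
both positivity and the analysis of 𝓔(x ⊗ y) = 0 can be done term by term. -/
lemma hasSum_inner_transOp (W : OpenQRW Λ H) (ρ : BlockState Λ H)
    (x y : SiteSpace Λ H →L[ℂ] SiteSpace Λ H) (v : SiteSpace Λ H) :
    HasSum (fun q : Λ × Λ =>
      coeff ρ x q.1 * ⟪W.B q.2 q.1 (v q.1), blockAt y q.2 (W.B q.2 q.1 (v q.1))⟫_ℂ)
      ⟪v, W.transOp ρ x y v⟫_ℂ := by
  have h := (innerSL ℂ v).hasSum (W.summable_term ρ x y v).hasSum
  simp only [innerSL_apply_apply, inner_term] at h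
  exact h

section Positivity

variable (W : OpenQRW Λ H) (ρ : BlockState Λ H) {x y : SiteSpace Λ H →L[ℂ] SiteSpace Λ H}

lemma coeff_mul_inner_nonneg (hx : 0 ≤ x) (hy : 0 ≤ y) (i j : Λ) (v : H) :
    0 ≤ coeff ρ x j * ⟪W.B i j v, blockAt y i (W.B i j v)⟫_ℂ :=
  mul_nonneg (coeff_nonneg ρ hx j) (nonneg_iff_inner.1 (blockAt_nonneg hy i) _)

lemma transOp_nonneg (hx : 0 ≤ x) (hy : 0 ≤ y) : 0 ≤ W.transOp ρ x y :=
  nonneg_iff_inner.2 fun v => (W.hasSum_inner_transOp ρ x y v).nonneg fun _ =>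
    W.coeff_mul_inner_nonneg ρ hx hy _ _ _

lemma coeff_mul_inner_eq_zero (hx : 0 ≤ x) (hy : 0 ≤ y) (h : W.transOp ρ x y = 0) (i j : Λ)
    (v : H) : coeff ρ x j * ⟪W.B i j v, blockAt y i (W.B i j v)⟫_ℂ = 0 := by
  -- The test vector v ⊗ |j⟩ makes v itself the vector at site j.
  have h1 := W.hasSum_inner_transOp ρ x y (inj j v)
  rw [h, zero_apply, inner_zero_right,
    hasSum_zero_iff_of_nonneg fun _ => W.coeff_mul_inner_nonneg ρ hx hy _ _ _] at h1
  simpa [inj_apply_self] using congrFun h1 (j, i)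

end Positivity

/-- If all blocks of `ρ` are faithful then `𝓔(x ⊗ I) = 0` only for `x = 0`, among positive `x`. -/
lemma blockAt_eq_zero_of_transOp_one (W : OpenQRW Λ H) {ρ : BlockState Λ H} (hρ : ρ.IsFaithful)
    {x : SiteSpace Λ H →L[ℂ] SiteSpace Λ H} (hx : 0 ≤ x) (h : W.transOp ρ x 1 = 0) (j : Λ) :
    blockAt x j = 0 := by
  apply blockAt_eq_zero_of_coeff hρ hx
  by_contra hc
  have hB : ∀ (i : Λ) (v : H), W.B i j v = 0 := fun i v => by
    have := W.coeff_mul_inner_eq_zero ρ hx zero_le_one h i j v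
    simpa [blockAt_one, hc] using this
  -- If B i j = 0 for all i, then ‖w‖² = ∑ᵢ ‖B i j w‖² = 0 for every w. Taking w = ρⱼ v gives ρⱼ =
  -- 0.
  apply hρ.block_ne_zero j
  ext v
  have := W.hasSum_norm_sq j (ρ.block j v)
  simp only [hB, norm_zero, ne_eq, OfNat.ofNat_ne_zero, not_false_eq_true, zero_pow] at this
  simpa using this.unique hasSum_zero

/-- If all blocks of `𝓜(ρ)` are faithful then `𝓔(I ⊗ y) = 0` only for `y = 0`, among
positive `y`. -/
lemma blockAt_eq_zero_of_one_transOp (W : OpenQRW Λ H) {ρ : BlockState Λ H} (hρ : ρ.IsFaithful)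
    (hρ' : (W.step ρ).IsFaithful) {y : SiteSpace Λ H →L[ℂ] SiteSpace Λ H} (hy : 0 ≤ y)
    (h : W.transOp ρ 1 y = 0) (i : Λ) : blockAt y i = 0 := by
  have hyi := blockAt_nonneg hy i
  -- All coefficients are 1, so the form of y(i) vanishes on the range of B i j, and positivity
  -- upgrades this to y(i) vanishing there.
  have hB : ∀ j, blockAt y i * W.B i j = 0 := fun j => by
    ext v
    have := W.coeff_mul_inner_eq_zero ρ zero_le_one hy h i j v
    rw [coeff_one hρ, one_mul] at this
    exact apply_eq_zero_of_inner hyi this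
  have h1 : blockAt y i * (W.step ρ).block i = 0 := by
    change blockAt y i * ∑' j, W.B i j * ρ.block j * star (W.B i j) = 0
    rw [← (W.summable_conj ρ i).tsum_mul_left]
    simp [← mul_assoc, hB]
  -- Adjoints restore the order of factors used in the faithfulness condition.
  have h2 : (W.step ρ).block i * blockAt y i = 0 := by
    have := congrArg star h1
    rwa [star_mul, star_zero, (IsSelfAdjoint.of_nonneg hyi).star_eq,
      ((W.step ρ).isPositive i).isSelfAdjoint.star_eq] at this
  refine (hρ' i).eq_zero_of_trace_mul ((ContinuousLinearMap.nonneg_iff_isPositive _).1 hyi) ?_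
  rw [h2]
  simp [trace]

/-- Every coefficient is 1, so the quadratic form is ∑ ‖M i j v‖² = ‖v‖², and over ℂ the quadratic
form determines the operator. -/
lemma transExp_one_one (W : OpenQRW Λ H) {ρ : BlockState Λ H} (hρ : ρ.IsFaithful) :
    W.transExp ρ 1 1 = 1 := by
  have : W.transOp ρ 1 1 = 1 := by
    rw [← sub_eq_zero, ← ContinuousLinearMap.coe_inj, ContinuousLinearMap.toLinearMap_zero,
      ← inner_map_self_eq_zero]
    intro v
    rw [← inner_conj_symm, map_eq_zero]
    change ⟪v, W.transOp ρ 1 1 v - v⟫_ℂ = 0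
    rw [inner_sub_right, sub_eq_zero]
    have h := W.hasSum_inner_transOp ρ 1 1 v
    have e : ∀ i j : Λ, ‖W.M i j v‖ = ‖W.B i j (v j)‖ := by
      classical
      intro i j
      simp [M, elem, inj, lp.norm_single]
    have h2 : HasSum (fun q : Λ × Λ => ‖W.B q.2 q.1 (v q.1)‖ ^ 2) (‖v‖ ^ 2) := by
      simp only [← e]
      rw [← (W.hasSum_norm_M v).2]
      exact (W.hasSum_norm_M v).1.hasSum
    have h3 := Complex.ofRealCLM.hasSum h2
    simp only [Complex.ofRealCLM_apply] at h3
    simp only [coeff_one hρ, one_mul, blockAt_one, one_apply_eq_self, inner_self_eq_norm_sq_to_K]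
      at h ⊢
    refine h.unique ?_
    simpa [Function.comp_def] using h3
  exact Subtype.ext this

end OpenQRW

/-! ### Irreducibility of quantum Markov chains with faithful transition expectations. -/

namespace QMC

open scoped ComplexOrder

variable {G : Type*} [NormedAddCommGroup G] [InnerProductSpace ℂ G] [CompleteSpace G]
variable {𝓑 : StarSubalgebra ℂ (G →L[ℂ] G)} {E : ℕ → 𝓑 →ₗ[ℂ] 𝓑 →ₗ[ℂ] 𝓑}

lemma nested_sub (a : ℕ → 𝓑) (k m : ℕ) (y z : 𝓑) :
    nested E a k m (y - z) = nested E a k m y - nested E a k m z := by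
  induction m generalizing k with
  | zero => rfl
  | succ m ih => simp only [nested, ih, map_sub]

lemma nested_append (a : ℕ → 𝓑) (k m l : ℕ) (y : 𝓑) :
    nested E a k (m + l) y = nested E a k m (nested E a (k + m) l y) := by
  induction m generalizing k with
  | zero => simp [nested]
  | succ m ih => rw [Nat.succ_add, nested, nested, ih, Nat.succ_add_eq_add_succ]

lemma nested_congr {a b : ℕ → 𝓑} {k m : ℕ} (h : ∀ i, k ≤ i → i < k + m → a i = b i) (y : 𝓑) :
    nested E a k m y = nested E b k m y := by
  induction m generalizing k with
  | zero => rfl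
  | succ m ih =>
    rw [nested, nested, h k le_rfl (by omega), ih fun i hi hi' => h i (by omega) (by omega)]

lemma IsStrongLimit.eq_of_const {c b : 𝓑}
    (h : IsStrongLimit ((fun _ => c : ℕ → 𝓑) : Germ atTop 𝓑) b) : b = c := by
  ext v
  exact tendsto_nhds_unique (Germ.coe_tendsto.1 (h v)) tendsto_const_nhds

lemma isStrongLimit_const (c : 𝓑) : IsStrongLimit ((fun _ => c : ℕ → 𝓑) : Germ atTop 𝓑) c :=
  fun _ => Germ.coe_tendsto.2 tendsto_const_nhds

/-- The limit exists, so the default value 0 does not intervene, and uniqueness identifies the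
chosen limit. -/
lemma strongLimit_const (c : 𝓑) : strongLimit (fun _ => c) = c := by
  have h : ∃ b, IsStrongLimit ((fun _ => c : ℕ → 𝓑) : Germ atTop 𝓑) b := ⟨c, isStrongLimit_const c⟩
  rw [strongLimit, dif_pos h]
  exact h.choose_spec.eq_of_const

lemma nested_one (hE : ∀ n, E n 1 1 = 1) (k m : ℕ) : nested E 1 k m 1 = 1 := by
  induction m generalizing k with
  | zero => rfl
  | succ m ih => rw [nested, ih, Pi.one_apply, hE]

lemma bbar_eq_one (hE : ∀ n, E n 1 1 = 1) (n : ℕ) : bbar E n = 1 := by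
  simp only [bbar, nested_one hE, strongLimit_const]

lemma hasExp_one (hE : ∀ n, E n 1 1 = 1) : HasExp E 1 1 := by
  rw [HasExp, PiTensorProduct.one_def, expGerm_tprod]
  have : finiteExp E (1 : ℕ → 𝓑) = fun _ => 1 := by
    ext1 n
    rw [finiteExp, bbar_eq_one hE, nested_one hE]
  rw [this]
  exact isStrongLimit_const 1

lemma tailProj_mul_one_mul {p : 𝓑} (hp : p * p = p) (n : ℕ) :
    tailProj p n * 1 * tailProj p n = tailProj p n := by
  rw [mul_one, tailProj, PiTensorProduct.tprod_mul_tprod]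
  congr 1
  ext1 k
  rw [Pi.mul_apply]
  split_ifs
  · exact one_mul 1
  · exact hp

/-- The transition expectations are unital and positive, and each is faithful in both arguments
separately: for `x, y ≥ 0`, `𝓔⁽ⁿ⁾(x ⊗ I) = 0` only if `x = 0` and `𝓔⁽ⁿ⁾(I ⊗ y) = 0` only if
`y = 0`. -/
structure IsFaithful (E : ℕ → 𝓑 →ₗ[ℂ] 𝓑 →ₗ[ℂ] 𝓑) : Prop where
  one_one : ∀ n, E n 1 1 = 1
  nonneg : ∀ (n : ℕ) (x y : 𝓑), 0 ≤ (x : G →L[ℂ] G) → 0 ≤ (y : G →L[ℂ] G) →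
    0 ≤ (E n x y : G →L[ℂ] G)
  eq_zero_left : ∀ (n : ℕ) (x : 𝓑), 0 ≤ (x : G →L[ℂ] G) → E n x 1 = 0 → x = 0
  eq_zero_right : ∀ (n : ℕ) (y : 𝓑), 0 ≤ (y : G →L[ℂ] G) → E n 1 y = 0 → y = 0

namespace IsFaithful

lemma nested_nonneg (hE : IsFaithful E) {a : ℕ → 𝓑} (ha : ∀ n, 0 ≤ (a n : G →L[ℂ] G)) (k m : ℕ)
    {y : 𝓑} (hy : 0 ≤ (y : G →L[ℂ] G)) : 0 ≤ (nested E a k m y : G →L[ℂ] G) := by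
  induction m generalizing k with
  | zero => exact hy
  | succ m ih => exact hE.nonneg _ _ _ (ha k) (ih _)

/-- Telescoping through 𝓔(x ⊗ I): the defect from I splits into two parts, each positive when 0 ≤ x
≤ I and y ≤ I. -/
lemma one_sub_eq (hE : IsFaithful E) (n : ℕ) (x y : 𝓑) :
    1 - E n x y = E n (1 - x) 1 + E n x (1 - y) := by
  simp only [map_sub, LinearMap.sub_apply, hE.one_one]
  abel

lemma one_sub_nested_nonneg (hE : IsFaithful E) {p : 𝓑} (hp : 0 ≤ (p : G →L[ℂ] G))
    (hp' : 0 ≤ ((1 - p : 𝓑) : G →L[ℂ] G)) (k m : ℕ) :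
    0 ≤ ((1 - nested E (fun _ => p) k m 1 : 𝓑) : G →L[ℂ] G) := by
  induction m generalizing k with
  | zero => simp [nested]
  | succ m ih =>
    rw [nested, hE.one_sub_eq]
    exact add_nonneg (hE.nonneg _ _ _ hp' zero_le_one) (hE.nonneg _ _ _ hp (ih _))

/-- The layers 𝓔(I ⊗ ·) are peeled off from the outside. What remains inside is positive, so
faithfulness in the second argument applies each time. -/
lemma eq_zero_of_nested (hE : IsFaithful E) (k m : ℕ) {y : 𝓑} (hy : 0 ≤ (y : G →L[ℂ] G))
    (h : nested E 1 k m y = 0) : y = 0 := by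
  induction m generalizing k with
  | zero => exact h
  | succ m ih =>
    exact ih _ (hE.eq_zero_right k _ (hE.nested_nonneg (fun _ => zero_le_one) _ _ hy) h)

/-- Truncation at n₀ + m involves n₀ + m + 1 expectations: n₀ with entry I, the one at time n₀ where
p first appears, and m further ones with entry p. -/
lemma finiteExp_tail (hE : IsFaithful E) (p : 𝓑) (n₀ m : ℕ) :
    finiteExp E (fun k => if k < n₀ then 1 else p) (n₀ + m) =
      nested E 1 0 n₀ (E n₀ p (nested E (fun _ => p) (n₀ + 1) m 1)) := by
  have h1 : ∀ y, nested E (fun k => if k < n₀ then 1 else p) 0 n₀ y = nested E 1 0 n₀ y :=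
    nested_congr fun i _ hi => if_pos (by omega)
  have h2 : ∀ y, nested E (fun k => if k < n₀ then 1 else p) (n₀ + 1) m y =
      nested E (fun _ => p) (n₀ + 1) m y :=
    nested_congr fun i hi _ => if_neg (by omega)
  rw [finiteExp, bbar_eq_one hE.one_one, add_assoc, nested_append, zero_add, h1, nested, h2,
    if_neg (lt_irrefl _)]

/-- The defect created at time n₀ alone bounds the total defect from below, uniformly in m. The
remainder is the propagated defect 𝓔⁽ⁿ⁰⁾(p ⊗ (I - z)), with z ≤ I the later nested expression. -/
lemma nested_le_one_sub_finiteExp_tail (hE : IsFaithful E) {p : 𝓑} (hp : 0 ≤ (p : G →L[ℂ] G))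
    (hp' : 0 ≤ ((1 - p : 𝓑) : G →L[ℂ] G)) (n₀ m : ℕ) :
    (nested E 1 0 n₀ (E n₀ (1 - p) 1) : G →L[ℂ] G) ≤
      1 - finiteExp E (fun k => if k < n₀ then 1 else p) (n₀ + m) := by
  have h := hE.nested_nonneg (a := 1) (fun _ => zero_le_one) 0 n₀
    (hE.nonneg n₀ _ _ hp (hE.one_sub_nested_nonneg hp hp' (n₀ + 1) m))
  rw [← sub_nonneg]
  convert h using 1
  have e := hE.one_sub_eq n₀ p (nested E (fun _ => p) (n₀ + 1) m 1)
  rw [← sub_eq_iff_eq_add] at e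
  rw [hE.finiteExp_tail, ← e, nested_sub, nested_sub, nested_one hE.one_one]
  exact sub_sub_cancel _ _

theorem isIrreducible (hE : IsFaithful E) : IsIrreducible E := by
  rintro ⟨p, hp, -, hp1, n₀, hred⟩
  have hp0 : IsStarProjection (p : G →L[ℂ] G) := hp.map 𝓑.subtype
  have hlim := hred 1 1 (hasExp_one hE.one_one)
  rw [tailProj_mul_one_mul hp.isIdempotentElem, HasExp, tailProj, expGerm_tprod] at hlim
  have hp' : 0 ≤ ((1 - p : 𝓑) : G →L[ℂ] G) := hp0.one_sub_nonneg
  set x := nested E 1 0 n₀ (E n₀ (1 - p) 1) with hx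
  have hx0 : 0 ≤ (x : G →L[ℂ] G) :=
    hE.nested_nonneg (fun _ => zero_le_one) _ _ (hE.nonneg _ _ _ hp' zero_le_one)
  have hxz : x = 0 := by
    ext v
    -- The form of x at v is bounded by that of the total defect, which tends to 0 by the reducing
    -- property applied to I.
    refine apply_eq_zero_of_inner hx0 (le_antisymm ?_ (nonneg_iff_inner.1 hx0 v))
    -- The shift by n₀ keeps only truncations that reach the first p.
    have h1 := (Germ.coe_tendsto.1 (hlim v)).comp (tendsto_add_atTop_nat n₀)
    have h2 : Tendsto (fun m => ⟪v, v - (finiteExp E (fun k => if k < n₀ then 1 else p) (m + n₀) :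
        G →L[ℂ] G) v⟫_ℂ) atTop (𝓝 ⟪v, v - v⟫_ℂ) :=
      tendsto_const_nhds.inner (tendsto_const_nhds.sub h1)
    rw [sub_self, inner_zero_right] at h2
    refine ge_of_tendsto' h2 fun m => ?_
    have h3 := nonneg_iff_inner.1
      (sub_nonneg.2 (hE.nested_le_one_sub_finiteExp_tail hp0.nonneg hp' n₀ m)) v
    rw [sub_apply, inner_sub_right, add_comm n₀] at h3
    exact sub_nonneg.1 h3
  apply hp1
  have h1 := hE.eq_zero_of_nested 0 n₀ (hE.nonneg _ _ _ hp' zero_le_one) (hx.symm.trans hxz)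
  exact (sub_eq_zero.1 (hE.eq_zero_left n₀ _ hp' h1)).symm

end IsFaithful

end QMC

/-! ### Application to the chain of the walk. -/

theorem OpenQRW.isFaithful_qmc {Λ H : Type*} [NormedAddCommGroup H] [InnerProductSpace ℂ H]
    [CompleteSpace H] (W : OpenQRW Λ H) (ρ₀ : BlockState Λ H)
    (hρ : ∀ n, (W.stateAt ρ₀ n).IsFaithful) : QMC.IsFaithful (W.qmc ρ₀) where
  one_one n := W.transExp_one_one (hρ n)
  nonneg n _ _ hx hy := W.transOp_nonneg (W.stateAt ρ₀ n) hx hy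
  eq_zero_left n _ hx h := SiteSpace.eq_zero_of_blockAt
    (W.blockAt_eq_zero_of_transOp_one (hρ n) hx (congrArg Subtype.val h))
  eq_zero_right n y hy h := by
    -- Faithfulness in the second argument at time n draws on the state at time n + 1, which is one
    -- step of the walk from time n.
    have hstep : (W.step (W.stateAt ρ₀ n)).IsFaithful := by
      have := hρ (n + 1)
      rwa [OpenQRW.stateAt, Function.iterate_succ_apply'] at this
    exact SiteSpace.eq_zero_of_blockAt
      (W.blockAt_eq_zero_of_one_transOp (hρ n) hstep hy (congrArg Subtype.val h))

end

theorem mainTheorem4 {Λ H : Type*} [Countable Λ] [NormedAddCommGroup H] [InnerProductSpace ℂ H]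
    [CompleteSpace H] [TopologicalSpace.SeparableSpace H]
    (W : OpenQRW Λ H) (ρ₀ : BlockState Λ H)
    (hfaithful : ∀ (n : ℕ) (j : Λ), HilbertTrace.IsFaithfulState
      ((HilbertTrace.trace ((W.stateAt ρ₀ n).block j))⁻¹ • (W.stateAt ρ₀ n).block j)) :
    QMC.IsIrreducible (W.qmc ρ₀) :=
  (W.isFaithful_qmc ρ₀ hfaithful).isIrreducible
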